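/- **Proposition 4.1.** A *labelled cubic graph* of order $n$ is a connected multigraph (loops and multiple edges allowed) on the vertex set $\{0,\dots,n-1\}$ in which every vertex has degree $3$, a loop counting twice; two such graphs are equal if each pair of (not necessarily distinct) labels is joined by the same number of edges in both. A *Whitehead move* on an edge $uv$ with $u\neq v$ takes a further edge $ux$ at $u$ and a further edge $vy$ at $v$ (the three edges are different members of the edge multiset) and replaces $ux, vy$ by $vx, uy$. For even $n\ge 2$ let $\Gamma^l_n$ be the simple graph whose vertices are all labelled cubic graphs of order $n$, two distinct ones being adjacent if one can be transformed into the other by a Whitehead move. Then, as $n\to\infty$ through even integers, the average vertex degree of $\Gamma^l_n$ is at least $6n-O(1)$; that is, there is a constant $C$ such that for every even $n\ge 2$ $$\frac{1}{|V(\Gamma^l_n)|}\sum_{G\in V(\Gamma^l_n)}\deg_{\Gamma^l_n}(G)\;\ge\; 6n-C .$$ -/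

import Mathlib

/-- The degree of the vertex `v` in the multigraph with vertex set `V` whose edges, listed with
multiplicity, are the unordered pairs in `E`. A loop at `v` counts twice. -/
def multigraphDegree {V : Type*} [DecidableEq V] (E : Multiset (Sym2 V)) (v : V) : ℕ :=
  E.countP (fun e => v ∈ e) + E.count s(v, v)

/-- A (vertex-)labelled cubic graph of order `n`: a connected multigraph on the vertex set
`{0, …, n - 1}`, possibly with loops and multiple edges, all of whose vertices have degree `3`.
It is given by the multiset of its edges, so two labelled cubic graphs are the same exactly
when every pair of labels is joined by the same number of edges in both. -/
@[ext]
structure LabelledCubicGraph (n : ℕ) where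
  /-- The multiset of edges. -/
  edges : Multiset (Sym2 (Fin n))
  /-- Every vertex has degree `3`. -/
  degree_eq : ∀ v : Fin n, multigraphDegree edges v = 3
  /-- The graph is connected (parallel edges and loops are irrelevant for this). -/
  connected : (SimpleGraph.fromEdgeSet {e : Sym2 (Fin n) | e ∈ edges}).Connected

/-- `WhiteheadMove E F`: the multigraph `F` arises from the multigraph `E` by a Whitehead move.
There are an edge `uv` that is not a loop, a further edge `ux` at its endpoint `u` and a further
edge `vy` at its endpoint `v` (three different members of the multiset `E`, though possibly
parallel, and possibly loops in the case of the last two), and the last two edges are swapped: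
`ux`, `vy` are replaced by `vx`, `uy`. -/
def WhiteheadMove {V : Type*} [DecidableEq V] (E F : Multiset (Sym2 V)) : Prop :=
  ∃ u v x y : V, u ≠ v ∧ {s(u, v), s(u, x), s(v, y)} ≤ E ∧
    F = E - {s(u, x), s(v, y)} + {s(v, x), s(u, y)}

theorem WhiteheadMove.symm {V : Type*} [DecidableEq V] {E F : Multiset (Sym2 V)}
    (h : WhiteheadMove E F) : WhiteheadMove F E := by
  obtain ⟨u, v, x, y, huv, hle, rfl⟩ := h
  obtain ⟨R, rfl⟩ := Multiset.le_iff_exists_add.1 hle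
  have key : ∀ a b c d e : Sym2 V,
      ({a, b, c} : Multiset (Sym2 V)) + R - {b, c} + {d, e} = {a, e, d} + R := by
    intro a b c d e
    have : ({a, b, c} : Multiset (Sym2 V)) + R = {b, c} + ({a} + R) := by
      rw [← add_assoc, add_comm ({b, c} : Multiset (Sym2 V)) {a}]; rfl
    rw [this, add_tsub_cancel_left]
    have h2 : ({a, e, d} : Multiset (Sym2 V)) = {a} + {d, e} := by
      rw [Multiset.pair_comm d e]; rfl
    rw [h2, add_right_comm]
  refine ⟨u, v, y, x, huv, ?_, ?_⟩
  · rw [key]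
    exact Multiset.le_add_right _ _
  · rw [key, key]

/-- The graph `Γˡₙ` of Whitehead moves: its vertices are the labelled cubic graphs of order `n`,
and two distinct ones are adjacent if a Whitehead move transforms one into the other. -/
def whiteheadGraph (n : ℕ) : SimpleGraph (LabelledCubicGraph n) where
  Adj G H := G ≠ H ∧ WhiteheadMove G.edges H.edges
  symm := ⟨fun _ _ h => ⟨h.1.symm, h.2.symm⟩⟩
  loopless := ⟨fun _ h => h.1 rfl⟩

instance LabelledCubicGraph.instFinite (n : ℕ) : Finite (LabelledCubicGraph n) := by
  have hb : ∀ (G : LabelledCubicGraph n) (e : Sym2 (Fin n)), G.edges.count e < 4 := by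
    intro G e
    induction e with
    | h a b =>
      have h1 := G.degree_eq a
      have h2 : G.edges.count s(a, b) ≤ G.edges.countP (fun e => a ∈ e) := by
        rw [Multiset.count, Multiset.countP_eq_card_filter, Multiset.countP_eq_card_filter]
        refine Multiset.card_le_card (Multiset.monotone_filter_right _ ?_)
        rintro e rfl
        exact Sym2.mem_mk_left a b
      unfold multigraphDegree at h1
      omega
  refine Finite.of_injective
    (fun (G : LabelledCubicGraph n) (e : Sym2 (Fin n)) => (⟨G.edges.count e, hb G e⟩ : Fin 4)) ?_
  intro G H h
  refine LabelledCubicGraph.ext (Multiset.ext.2 fun e => ?_)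
  exact congrArg Fin.val (congrFun h e)

noncomputable instance LabelledCubicGraph.instFintype (n : ℕ) : Fintype (LabelledCubicGraph n) :=
  Fintype.ofFinite _

noncomputable instance whiteheadGraph.instDecidableRelAdj (n : ℕ) :
    DecidableRel (whiteheadGraph n).Adj :=
  Classical.decRel _

/-- The average vertex degree of a finite simple graph. -/
noncomputable def averageDegree {V : Type*} [Fintype V] (G : SimpleGraph V)
    [DecidableRel G.Adj] : ℝ :=
  (∑ v : V, (G.degree v : ℝ)) / (Fintype.card V : ℝ)

/-! A Whitehead move runs along a path x, u, v, y, and the reversed path gives the same move. A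
cubic graph without loops, multiple edges, triangles and quadrilaterals has 3n · 4 = 12n such paths,
hence 6n moves, and different moves give different graphs: comparing edge multiplicities recovers
the path up to reversal (`moveAlong_eq`). In general the loss is at most a constant times the number
of local obstructions, namely vertices with loops or parallel edges, and paths with x = y or xy an
edge (`LabelledCubicGraph.le_degree`). It remains to see that there are O(1) obstructions on
average.

Fix a ≠ b and let H range over the multigraphs that are cubic and connected off {a, b}. If an
obstruction sits at the edge ab, then a and b can be deleted and the loose ends rejoined without
losing connectivity; this yields some H, and the original graph is recovered from H and one of O(n)
markings (`card_hasPendantLoop_le`, `card_hasDoubleEdge_le`, `card_hasShortCycle_le`). Conversely,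
subdividing two edges of H by a and b and joining a to b produces, in about n² ways, a cubic graph
containing ab, and each such graph arises at most 81 times (`mul_card_cubicOff_le`). Let T be the
number of triples (a, b, H) and N the number of cubic graphs. The obstructions number O(nT), while
n²T = O(nN), because a cubic graph has at most 3n ordered pairs of adjacent vertices. So there are
O(N) obstructions in total. -/

open Multiset

/-! ### Reachability in the underlying simple graph. -/

section EdgeGraph

variable {V : Type*}

/-- The simple graph underlying a multigraph. -/
abbrev edgeGraph (E : Multiset (Sym2 V)) : SimpleGraph V :=
  SimpleGraph.fromEdgeSet {e : Sym2 V | e ∈ E}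

theorem reachable_of_mem {E : Multiset (Sym2 V)} {a b : V} (h : s(a, b) ∈ E) :
    (edgeGraph E).Reachable a b := by
  by_cases hab : a = b
  · subst hab; rfl
  · exact SimpleGraph.Adj.reachable (by simp [hab, h])

theorem reachable_of_forall_mem {E F : Multiset (Sym2 V)} (φ : V → V)
    (h : ∀ u w, s(u, w) ∈ E → (edgeGraph F).Reachable (φ u) (φ w)) {u w : V}
    (huw : (edgeGraph E).Reachable u w) : (edgeGraph F).Reachable (φ u) (φ w) := by
  obtain ⟨p⟩ := huw
  induction p with
  | nil => rfl
  | cons hadj _ ih => exact (h _ _ (by simpa using hadj.1)).trans ih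

end EdgeGraph

/-! ### Degrees in multigraphs. -/

section Multigraph

variable {V : Type*} [DecidableEq V]

@[simp]
theorem multigraphDegree_zero (v : V) : multigraphDegree (0 : Multiset (Sym2 V)) v = 0 := rfl

@[simp]
theorem multigraphDegree_cons_mk (a b : V) (R : Multiset (Sym2 V)) (v : V) :
    multigraphDegree (s(a, b) ::ₘ R) v =
      (if a = v then 1 else 0) + (if b = v then 1 else 0) + multigraphDegree R v := by
  unfold multigraphDegree
  rw [Multiset.countP_cons, Multiset.count_cons]
  by_cases h1 : a = v <;> by_cases h2 : b = v
  · subst h1; subst h2; simp; ring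
  · subst h1; simp [Ne.symm h2, h2]; ring
  · subst h2; simp [Ne.symm h1, h1]; ring
  · simp [Ne.symm h1, Ne.symm h2, h1, h2]

theorem multigraphDegree_add (E F : Multiset (Sym2 V)) (v : V) :
    multigraphDegree (E + F) v = multigraphDegree E v + multigraphDegree F v := by
  simp [multigraphDegree]; ring

theorem exists_eq_cons_of_degree_pos {E : Multiset (Sym2 V)} {v : V}
    (h : 0 < multigraphDegree E v) : ∃ w R, E = s(v, w) ::ₘ R := by
  have h1 : ∃ e ∈ E, v ∈ e := by
    by_contra! hc
    have h2 : E.countP (fun e => v ∈ e) = 0 := Multiset.countP_eq_zero.2 hc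
    have h3 : E.count s(v, v) = 0 := Multiset.count_eq_zero.2 fun hm => hc _ hm (by simp)
    unfold multigraphDegree at h
    omega
  obtain ⟨e, he, w, rfl⟩ := h1
  obtain ⟨R, hR⟩ := Multiset.exists_cons_of_mem he
  exact ⟨w, R, hR⟩

theorem degree_pos_of_mem_left {E : Multiset (Sym2 V)} {v w : V} (h : s(v, w) ∈ E) :
    0 < multigraphDegree E v := by
  obtain ⟨R, rfl⟩ := Multiset.exists_cons_of_mem h
  simp

theorem degree_pos_of_mem_right {E : Multiset (Sym2 V)} {v w : V} (h : s(v, w) ∈ E) :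
    0 < multigraphDegree E w := by
  obtain ⟨R, rfl⟩ := Multiset.exists_cons_of_mem h
  simp

/-! ### Deleting and inserting an edge ab in a cubic graph. -/

/-- The multigraph `H` is cubic and connected on the complement of `{a, b}`, and has no edges
at `a` and `b`. -/
structure IsCubicOff (a b : V) (H : Multiset (Sym2 V)) : Prop where
  degree_left : multigraphDegree H a = 0
  degree_right : multigraphDegree H b = 0
  degree_eq : ∀ v, v ≠ a → v ≠ b → multigraphDegree H v = 3
  reachable : ∀ v w, v ≠ a → v ≠ b → w ≠ a → w ≠ b → (edgeGraph H).Reachable v w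

/-- A cubic connected multigraph. -/
structure IsCubic (E : Multiset (Sym2 V)) : Prop where
  degree_eq : ∀ v, multigraphDegree E v = 3
  connected : (edgeGraph E).Connected

theorem IsCubicOff.degree_le {a b : V} {H : Multiset (Sym2 V)} (h : IsCubicOff a b H) (v : V) :
    multigraphDegree H v ≤ 3 := by
  by_cases ha : v = a
  · rw [ha, h.degree_left]; omega
  by_cases hb : v = b
  · rw [hb, h.degree_right]; omega
  exact (h.degree_eq v ha hb).le

theorem IsCubicOff.ne_of_mem {a b u w : V} {H : Multiset (Sym2 V)} (h : IsCubicOff a b H)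
    (hm : s(u, w) ∈ H) : u ≠ a ∧ u ≠ b ∧ w ≠ a ∧ w ≠ b := by
  have h1 := degree_pos_of_mem_left hm
  have h2 := degree_pos_of_mem_right hm
  have h3 := h.degree_left
  have h4 := h.degree_right
  refine ⟨?_, ?_, ?_, ?_⟩ <;> rintro rfl <;> omega

/-- The edge pq is subdivided by a, the edge rt by b, and a is joined to b. Each subdivided edge
survives as a path through its new vertex, so connectivity persists. -/
theorem IsCubicOff.isCubic_insert {a b p q r t : V} {R : Multiset (Sym2 V)} (hab : a ≠ b)
    (h : IsCubicOff a b (s(p, q) ::ₘ s(r, t) ::ₘ R)) :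
    IsCubic (s(a, b) ::ₘ s(p, a) ::ₘ s(q, a) ::ₘ s(r, b) ::ₘ s(t, b) ::ₘ R) := by
  obtain ⟨pa, pb, qa, qb⟩ := h.ne_of_mem (u := p) (w := q) (by simp)
  obtain ⟨ra, rb, ta, tb⟩ := h.ne_of_mem (u := r) (w := t) (by simp)
  set E := s(a, b) ::ₘ s(p, a) ::ₘ s(q, a) ::ₘ s(r, b) ::ₘ s(t, b) ::ₘ R with hE
  have hpa : (edgeGraph E).Reachable p a := reachable_of_mem (by simp [hE])
  have hqa : (edgeGraph E).Reachable q a := reachable_of_mem (by simp [hE])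
  have hrb : (edgeGraph E).Reachable r b := reachable_of_mem (by simp [hE])
  have htb : (edgeGraph E).Reachable t b := reachable_of_mem (by simp [hE])
  have hba : (edgeGraph E).Reachable b a := (reachable_of_mem (by simp [hE])).symm
  refine ⟨fun v => ?_, ?_⟩
  · by_cases hva : v = a
    · have := h.degree_left
      subst hva
      simp [pa, qa, ra, ta] at this
      simp [hE, pa, qa, ra, ta, hab.symm, this]
    by_cases hvb : v = b
    · have := h.degree_right
      subst hvb
      simp [pb, qb, rb, tb] at this
      simp [hE, pb, qb, rb, tb, hab, this]
    have := h.degree_eq v hva hvb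
    simp only [multigraphDegree_cons_mk] at this
    simp only [hE, multigraphDegree_cons_mk, Ne.symm hva, Ne.symm hvb, if_false]
    omega
  · have key : ∀ u w, s(u, w) ∈ s(p, q) ::ₘ s(r, t) ::ₘ R → (edgeGraph E).Reachable u w := by
      intro u w huw
      rw [Multiset.mem_cons, Multiset.mem_cons] at huw
      rcases huw with huw | huw | huw
      · rcases Sym2.eq_iff.1 huw with ⟨rfl, rfl⟩ | ⟨rfl, rfl⟩
        exacts [hpa.trans hqa.symm, hqa.trans hpa.symm]
      · rcases Sym2.eq_iff.1 huw with ⟨rfl, rfl⟩ | ⟨rfl, rfl⟩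
        exacts [hrb.trans htb.symm, htb.trans hrb.symm]
      · exact reachable_of_mem (by simp [hE, huw])
    have key2 : ∀ v, (edgeGraph E).Reachable v a := by
      intro v
      by_cases hva : v = a
      · subst hva; rfl
      by_cases hvb : v = b
      · subst hvb; exact hba
      exact (reachable_of_forall_mem id key (h.reachable v p hva hvb pa pb)).trans hpa
    have : Nonempty V := ⟨a⟩
    exact ⟨fun v w => (key2 v).trans (key2 w).symm⟩

/-- Reachability off `{a, b}` in a multigraph obtained by deleting `a` and `b`, given the images
of `a` and `b` under a retraction. -/
theorem reachable_of_retract {E F : Multiset (Sym2 V)} {a b a' b' : V} (hab : a ≠ b)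
    (hE : (edgeGraph E).Connected)
    (h : ∀ u w, s(u, w) ∈ E → u ≠ a → u ≠ b → w ≠ a → w ≠ b → (edgeGraph F).Reachable u w)
    (haa : ∀ w, s(a, w) ∈ E → w ≠ a → w ≠ b → (edgeGraph F).Reachable a' w)
    (hbb : ∀ w, s(b, w) ∈ E → w ≠ a → w ≠ b → (edgeGraph F).Reachable b' w)
    (h' : (edgeGraph F).Reachable a' b') (v w : V)
    (hva : v ≠ a) (hvb : v ≠ b) (hwa : w ≠ a) (hwb : w ≠ b) : (edgeGraph F).Reachable v w := by
  set φ : V → V := fun u => if u = a then a' else if u = b then b' else u with hφ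
  have h1 : φ a = a' := by simp [hφ]
  have h2 : φ b = b' := by simp [hφ, hab.symm]
  have h3 : ∀ u, u ≠ a → u ≠ b → φ u = u := fun u h1 h2 => by simp [hφ, h1, h2]
  rw [← h3 v hva hvb, ← h3 w hwa hwb]
  refine reachable_of_forall_mem φ (fun u w huw => ?_) (hE v w)
  by_cases hua : u = a
  · subst hua
    by_cases hwa : w = u
    · rw [hwa]
    by_cases hwb : w = b
    · rw [hwb, h1, h2]; exact h'
    rw [h1, h3 w hwa hwb]; exact haa w huw hwa hwb
  by_cases hub : u = b
  · subst hub
    by_cases hwa : w = a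
    · rw [hwa, h1, h2]; exact h'.symm
    by_cases hwb : w = u
    · rw [hwb]
    rw [h2, h3 w hwa hwb]; exact hbb w huw hwa hwb
  rw [h3 u hua hub]
  by_cases hwa : w = a
  · rw [hwa, h1]; rw [hwa, Sym2.eq_swap] at huw; exact (haa u huw hua hub).symm
  by_cases hwb : w = b
  · rw [hwb, h2]; rw [hwb, Sym2.eq_swap] at huw; exact (hbb u huw hua hub).symm
  rw [h3 w hwa hwb]; exact h u w huw hua hub hwa hwb

theorem not_mem_of_degree_eq_zero {E : Multiset (Sym2 V)} {v w : V}
    (h : multigraphDegree E v = 0) : s(v, w) ∉ E := fun hm => by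
  have := degree_pos_of_mem_left hm; omega

/-- The vertex b hangs on a alone, so bypassing a by the edge cd loses no connection; a and b both
retract to c. -/
theorem IsCubic.delete_loop {a b c d : V} {R : Multiset (Sym2 V)} (hab : a ≠ b)
    (hc : c ≠ a) (hd : d ≠ a) (hcb : c ≠ b) (hdb : d ≠ b)
    (h : IsCubic (s(b, b) ::ₘ s(a, b) ::ₘ s(a, c) ::ₘ s(a, d) ::ₘ R)) :
    IsCubicOff a b (s(c, d) ::ₘ R) := by
  have h1 := h.degree_eq a
  have h2 := h.degree_eq b
  simp [hab, hab.symm, hc, hd, hcb, hdb] at h1 h2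
  replace h1 : multigraphDegree R a = 0 := by omega
  replace h2 : multigraphDegree R b = 0 := by omega
  have hcd : (edgeGraph (s(c, d) ::ₘ R)).Reachable c d := reachable_of_mem (by simp)
  refine ⟨by simp [hc, hd, h1], by simp [hcb, hdb, h2], fun v hva hvb => ?_, ?_⟩
  · have := h.degree_eq v
    simp only [multigraphDegree_cons_mk, Ne.symm hva, Ne.symm hvb, if_false] at this ⊢
    omega
  · refine reachable_of_retract (a' := c) (b' := c) hab h.connected ?_ ?_ ?_ ?_
    · intro u w huw hua hub hwa hwb
      refine reachable_of_mem ?_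
      simp [hua, hub, hwa, hwb] at huw
      simp [huw]
    · intro w hw hwa hwb
      have := not_mem_of_degree_eq_zero (w := w) h1
      simp [hab, hwa, hwb, this] at hw
      rcases hw with rfl | rfl
      · rfl
      · exact hcd
    · intro w hw hwa hwb
      have := not_mem_of_degree_eq_zero (w := w) h2
      simp [hab.symm, hwa, hwb, this, hcb.symm, hdb.symm] at hw
    · rfl

/-- The path c, a, b, d shrinks to the edge cd; a retracts to c and b to d. -/
theorem IsCubic.delete_double {a b c d : V} {R : Multiset (Sym2 V)} (hab : a ≠ b)
    (hc : c ≠ a) (hd : d ≠ a) (hcb : c ≠ b) (hdb : d ≠ b)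
    (h : IsCubic (s(a, b) ::ₘ s(a, b) ::ₘ s(a, c) ::ₘ s(b, d) ::ₘ R)) :
    IsCubicOff a b (s(c, d) ::ₘ R) := by
  have h1 := h.degree_eq a
  have h2 := h.degree_eq b
  simp [hab, hab.symm, hc, hd, hcb, hdb] at h1 h2
  replace h1 : multigraphDegree R a = 0 := by omega
  replace h2 : multigraphDegree R b = 0 := by omega
  have hcd : (edgeGraph (s(c, d) ::ₘ R)).Reachable c d := reachable_of_mem (by simp)
  refine ⟨by simp [hc, hd, h1], by simp [hcb, hdb, h2], fun v hva hvb => ?_, ?_⟩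
  · have := h.degree_eq v
    simp only [multigraphDegree_cons_mk, Ne.symm hva, Ne.symm hvb, if_false] at this ⊢
    omega
  · refine reachable_of_retract (a' := c) (b' := d) hab h.connected ?_ ?_ ?_ hcd
    · intro u w huw hua hub hwa hwb
      refine reachable_of_mem ?_
      simp [hua, hub, hwa, hwb] at huw
      simp [huw]
    · intro w hw hwa hwb
      have := not_mem_of_degree_eq_zero (w := w) h1
      simp [hab, hwa, hwb, this, hd.symm] at hw
      rw [hw]
    · intro w hw hwa hwb
      have := not_mem_of_degree_eq_zero (w := w) h2
      simp [hab.symm, hwa, hwb, this, hcb.symm, hdb.symm] at hw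
      rw [hw]

/-- Deleting ab could disconnect the graph if ab were a bridge. The hypothesis `hxy` closes ab up to
a triangle or quadrilateral, so x and y, the images of a and b under the retraction, stay connected.
-/
theorem IsCubic.delete_edge {a b c d x y : V} {R : Multiset (Sym2 V)} (hab : a ≠ b)
    (hc : c ≠ a) (hd : d ≠ a) (hcb : c ≠ b) (hdb : d ≠ b)
    (hx : x ≠ a) (hy : y ≠ a) (hxb : x ≠ b) (hyb : y ≠ b)
    (h : IsCubic (s(a, b) ::ₘ s(a, x) ::ₘ s(a, c) ::ₘ s(b, y) ::ₘ s(b, d) ::ₘ R))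
    (hxy : x = y ∨ s(x, y) ∈ R) :
    IsCubicOff a b (s(c, x) ::ₘ s(d, y) ::ₘ R) := by
  have h1 := h.degree_eq a
  have h2 := h.degree_eq b
  simp [hab, hab.symm, hc, hd, hcb, hdb, hx, hy, hxb, hyb] at h1 h2
  replace h1 : multigraphDegree R a = 0 := by omega
  replace h2 : multigraphDegree R b = 0 := by omega
  have hcx : (edgeGraph (s(c, x) ::ₘ s(d, y) ::ₘ R)).Reachable c x := reachable_of_mem (by simp)
  have hdy : (edgeGraph (s(c, x) ::ₘ s(d, y) ::ₘ R)).Reachable d y := reachable_of_mem (by simp)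
  refine ⟨by simp [hc, hd, hx, hy, h1], by simp [hcb, hdb, hxb, hyb, h2], fun v hva hvb => ?_, ?_⟩
  · have := h.degree_eq v
    simp only [multigraphDegree_cons_mk, Ne.symm hva, Ne.symm hvb, if_false] at this ⊢
    omega
  · refine reachable_of_retract (a' := x) (b' := y) hab h.connected ?_ ?_ ?_ ?_
    · intro u w huw hua hub hwa hwb
      refine reachable_of_mem ?_
      simp [hua, hub, hwa, hwb] at huw
      simp [huw]
    · intro w hw hwa hwb
      have := not_mem_of_degree_eq_zero (w := w) h1
      simp [hab, hwa, hwb, this, hd.symm, hy.symm] at hw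
      rcases hw with rfl | rfl
      · rfl
      · exact hcx.symm
    · intro w hw hwa hwb
      have := not_mem_of_degree_eq_zero (w := w) h2
      simp [hab.symm, hwa, hwb, this, hcb.symm, hxb.symm] at hw
      rcases hw with rfl | rfl
      · rfl
      · exact hdy.symm
    · rcases hxy with rfl | hxy
      · rfl
      · exact reachable_of_mem (by simp [hxy])

/-- The edge uv is kept, so the lost edge ux is replaced by the path u, v, x, and vy by v, u, y. -/
theorem IsCubic.whitehead {u v x y : V} {R : Multiset (Sym2 V)}
    (h : IsCubic (s(u, v) ::ₘ s(u, x) ::ₘ s(v, y) ::ₘ R)) :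
    IsCubic (s(u, v) ::ₘ s(v, x) ::ₘ s(u, y) ::ₘ R) := by
  set F := s(u, v) ::ₘ s(v, x) ::ₘ s(u, y) ::ₘ R with hF
  have huv : (edgeGraph F).Reachable u v := reachable_of_mem (by simp [hF])
  have hvx : (edgeGraph F).Reachable v x := reachable_of_mem (by simp [hF])
  have huy : (edgeGraph F).Reachable u y := reachable_of_mem (by simp [hF])
  refine ⟨fun w => ?_, ?_⟩
  · have := h.degree_eq w
    simp only [hF, multigraphDegree_cons_mk] at this ⊢
    omega
  · have := h.connected.nonempty
    refine ⟨fun p q => reachable_of_forall_mem id (fun a b hab => ?_) (h.connected p q)⟩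
    simp only [Multiset.mem_cons] at hab
    rcases hab with hab | hab | hab | hab
    · exact reachable_of_mem (by simp [hF, hab])
    · rcases Sym2.eq_iff.1 hab with ⟨rfl, rfl⟩ | ⟨rfl, rfl⟩
      exacts [huv.trans hvx, (huv.trans hvx).symm]
    · rcases Sym2.eq_iff.1 hab with ⟨rfl, rfl⟩ | ⟨rfl, rfl⟩
      exacts [huv.symm.trans huy, (huv.symm.trans huy).symm]
    · exact reachable_of_mem (by simp [hF, hab])

/-- In a connected multigraph on more than two vertices, some edge leaves a given pair. -/
theorem exists_mem_leaving {E : Multiset (Sym2 V)} (hE : (edgeGraph E).Connected) {a b z : V}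
    (hza : z ≠ a) (hzb : z ≠ b) :
    ∃ u w, s(u, w) ∈ E ∧ (u = a ∨ u = b) ∧ w ≠ a ∧ w ≠ b := by
  by_contra! hc
  have : ∀ w, (edgeGraph E).Reachable a w → w = a ∨ w = b := by
    rintro w ⟨p⟩
    suffices ∀ u w (p : (edgeGraph E).Walk u w), u = a ∨ u = b → w = a ∨ w = b from
      this a w p (Or.inl rfl)
    intro u w p
    induction p with
    | nil => exact id
    | cons hadj _ ih =>
      intro hu
      refine ih ?_
      by_contra! h'
      exact h'.2 (hc _ _ (by simpa using hadj.1) hu h'.1)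
  rcases this z (hE a z) with h | h
  exacts [hza h, hzb h]

theorem IsCubic.exists_of_loop {E : Multiset (Sym2 V)} (h : IsCubic E) {b : V}
    (hb : s(b, b) ∈ E) (hV : ∀ a : V, ∃ z, z ≠ a ∧ z ≠ b) :
    ∃ a c d R, a ≠ b ∧ c ≠ a ∧ d ≠ a ∧ c ≠ b ∧ d ≠ b ∧
      E = s(b, b) ::ₘ s(a, b) ::ₘ s(a, c) ::ₘ s(a, d) ::ₘ R := by
  obtain ⟨R, rfl⟩ := Multiset.exists_cons_of_mem hb
  have h1 := h.degree_eq b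
  simp at h1
  obtain ⟨a, R, rfl⟩ := exists_eq_cons_of_degree_pos (v := b) (E := R) (by omega)
  simp at h1
  have hab : a ≠ b := by rintro rfl; simp at h1; omega
  simp [hab] at h1
  have h2 := h.degree_eq a
  simp [hab.symm] at h2
  obtain ⟨c, R, rfl⟩ := exists_eq_cons_of_degree_pos (v := a) (E := R) (by omega)
  simp [hab] at h1 h2
  have hcb : c ≠ b := by rintro rfl; simp at h1; omega
  simp [hcb] at h1
  replace h1 : multigraphDegree R b = 0 := by omega
  -- Otherwise a and b both carry a loop and {a, b} is a whole component, although a third vertex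
  -- exists.
  have hca : c ≠ a := by
    rintro rfl
    simp at h2
    replace h2 : multigraphDegree R c = 0 := by omega
    obtain ⟨z, hz⟩ := hV c
    obtain ⟨u, w, hm, hu, hwa, hwb⟩ := exists_mem_leaving h.connected hz.1 hz.2
    have h3 := not_mem_of_degree_eq_zero (w := w) h1
    have h4 := not_mem_of_degree_eq_zero (w := w) h2
    rcases hu with rfl | rfl <;> simp [*] at hm
  simp [hca] at h2
  obtain ⟨d, R, rfl⟩ := exists_eq_cons_of_degree_pos (v := a) (E := R) (by omega)
  simp [hab] at h1 h2
  refine ⟨a, c, d, R, hab, hca, ?_, hcb, h1.1, ?_⟩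
  · rintro rfl; simp at h2; omega
  · rw [Sym2.eq_swap (a := a) (b := b)]

theorem IsCubic.exists_of_double {E : Multiset (Sym2 V)} (h : IsCubic E) {a b : V} (hab : a ≠ b)
    (hm : 2 ≤ E.count s(a, b)) (hV : ∃ z, z ≠ a ∧ z ≠ b) :
    ∃ c d R, c ≠ a ∧ d ≠ a ∧ c ≠ b ∧ d ≠ b ∧
      E = s(a, b) ::ₘ s(a, b) ::ₘ s(a, c) ::ₘ s(b, d) ::ₘ R := by
  obtain ⟨R, rfl⟩ := Multiset.exists_cons_of_mem (Multiset.count_pos.1 (by omega : 0 < E.count s(a, b)))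
  rw [Multiset.count_cons_self] at hm
  obtain ⟨R, rfl⟩ := Multiset.exists_cons_of_mem (Multiset.count_pos.1 (by omega : 0 < R.count s(a, b)))
  have h1 := h.degree_eq a
  have h2 := h.degree_eq b
  simp [hab, hab.symm] at h1 h2
  obtain ⟨c, R, rfl⟩ := exists_eq_cons_of_degree_pos (v := a) (E := R) (by omega)
  have hca : c ≠ a := by rintro rfl; simp at h1; omega
  simp [hca, hab] at h1 h2
  replace h1 : multigraphDegree R a = 0 := by omega
  -- Otherwise a and b are joined by a triple edge and form a whole component.
  have hcb : c ≠ b := by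
    rintro rfl
    simp at h2
    replace h2 : multigraphDegree R c = 0 := by omega
    obtain ⟨z, hz⟩ := hV
    obtain ⟨u, w, hm, hu, hwa, hwb⟩ := exists_mem_leaving h.connected hz.1 hz.2
    have h3 := not_mem_of_degree_eq_zero (w := w) h1
    have h4 := not_mem_of_degree_eq_zero (w := w) h2
    rcases hu with rfl | rfl <;> simp [*] at hm
  simp [hcb] at h2
  obtain ⟨d, R, rfl⟩ := exists_eq_cons_of_degree_pos (v := b) (E := R) (by omega)
  simp [hab.symm] at h1 h2
  refine ⟨c, d, R, hca, ?_, hcb, ?_, rfl⟩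
  · exact h1.1
  · rintro rfl; simp at h2; omega

end Multigraph

/-! ### Neighbour counts, finiteness and counting by codes. -/

section Counting

variable {V : Type*} [DecidableEq V] [Fintype V]

/-- The vertices joined to `v` by an edge of the multigraph `E`. -/
def nbrs (E : Multiset (Sym2 V)) (v : V) : Finset V :=
  Finset.univ.filter fun w => s(v, w) ∈ E

@[simp]
theorem mem_nbrs {E : Multiset (Sym2 V)} {v w : V} : w ∈ nbrs E v ↔ s(v, w) ∈ E := by
  simp [nbrs]

theorem card_nbrs_le (E : Multiset (Sym2 V)) (v : V) :
    (nbrs E v).card ≤ multigraphDegree E v := by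
  induction E using Multiset.induction with
  | empty => simp [nbrs]
  | cons e R ih =>
    induction e with
    | h a b =>
      have hsub : nbrs (s(a, b) ::ₘ R) v ⊆
          ((if a = v then {b} else ∅) ∪ (if b = v then {a} else ∅)) ∪ nbrs R v := by
        intro w hw
        rw [mem_nbrs, Multiset.mem_cons] at hw
        rcases hw with hw | hw
        · rcases Sym2.eq_iff.1 hw with ⟨rfl, rfl⟩ | ⟨rfl, rfl⟩ <;> simp
        · simp [hw]
      refine (Finset.card_le_card hsub).trans ((Finset.card_union_le _ _).trans ?_)
      rw [multigraphDegree_cons_mk]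
      refine Nat.add_le_add ((Finset.card_union_le _ _).trans (Nat.add_le_add ?_ ?_)) ih
      · split_ifs <;> simp
      · split_ifs <;> simp

theorem finite_of_degree_le (k : ℕ) :
    {E : Multiset (Sym2 V) | ∀ v, multigraphDegree E v ≤ k}.Finite := by
  have hb : ∀ (E : {E : Multiset (Sym2 V) | ∀ v, multigraphDegree E v ≤ k}) (e : Sym2 V),
      E.1.count e < k + 1 := by
    rintro ⟨E, hE⟩ e
    induction e with
    | h a b =>
      have h1 := hE a
      have h2 : E.count s(a, b) ≤ E.countP (fun e => a ∈ e) := by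
        rw [Multiset.count, Multiset.countP_eq_card_filter, Multiset.countP_eq_card_filter]
        refine Multiset.card_le_card (Multiset.monotone_filter_right _ ?_)
        rintro e rfl
        exact Sym2.mem_mk_left a b
      unfold multigraphDegree at h1
      simp only
      omega
  refine Finite.of_injective (β := Sym2 V → Fin (k + 1)) (fun E e => ⟨E.1.count e, hb E e⟩) ?_
  intro E F h
  exact Subtype.ext (Multiset.ext.2 fun e => congrArg Fin.val (congrFun h e))

/-- The map `f` serves as a decoder: it only has to hit the images of the elements of `S`, and its
values at other codes are irrelevant. This permits decoders that erase edges without checking that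
they are present. -/
theorem card_le_card_of_code {α β γ : Type*} {S : Finset α} {T : Finset β} (f : β → γ)
    (g : α → γ) (hg : Function.Injective g) (h : ∀ s ∈ S, ∃ t ∈ T, f t = g s) :
    S.card ≤ T.card := by
  classical
  rw [← Finset.card_image_of_injective S hg]
  refine (Finset.card_le_card ?_).trans (Finset.card_image_le (s := T) (f := f))
  intro c hc
  obtain ⟨s, hs, rfl⟩ := Finset.mem_image.1 hc
  obtain ⟨t, ht, h'⟩ := h s hs
  exact Finset.mem_image.2 ⟨t, ht, h'⟩

end Counting

/-! ### Comparing graphs with an obstruction at ab to graphs that are cubic off {a, b}. -/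

section Off

variable {V : Type*} [DecidableEq V] [Fintype V]

/-- The finite set of multigraphs that are cubic and connected off `{a, b}`. -/
noncomputable def cubicOff (a b : V) : Finset (Multiset (Sym2 V)) :=
  Set.Finite.toFinset (s := {H | IsCubicOff a b H})
    ((finite_of_degree_le 3).subset fun _ h v => h.degree_le v)

@[simp]
theorem mem_cubicOff {a b : V} {H : Multiset (Sym2 V)} : H ∈ cubicOff a b ↔ IsCubicOff a b H := by
  simp [cubicOff]

theorem IsCubicOff.card_nbrs_le {a b : V} {H : Multiset (Sym2 V)} (h : IsCubicOff a b H) (v : V) :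
    (nbrs H v).card ≤ 3 :=
  (_root_.card_nbrs_le H v).trans (h.degree_le v)

theorem IsCubic.card_nbrs_le {H : Multiset (Sym2 V)} (h : IsCubic H) (v : V) :
    (nbrs H v).card ≤ 3 :=
  (_root_.card_nbrs_le H v).trans (h.degree_eq v).le

theorem IsCubicOff.card_darts_le {a b : V} {H : Multiset (Sym2 V)} (h : IsCubicOff a b H) :
    (Finset.univ.sigma (nbrs H)).card ≤ 3 * Fintype.card V := by
  rw [Finset.card_sigma, mul_comm]
  exact Finset.sum_le_card_nsmul _ _ _ fun v _ => h.card_nbrs_le v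

/-- These are the markings from which a short cycle is rebuilt: n choices of x, then 3 of a
neighbour c, 4 of y among x and its neighbours, and 3 of a neighbour d of y. -/
theorem IsCubicOff.card_walks_le {a b : V} {H : Multiset (Sym2 V)} (h : IsCubicOff a b H) :
    (Finset.univ.sigma fun x => nbrs H x ×ˢ (insert x (nbrs H x)).sigma (nbrs H)).card ≤
      36 * Fintype.card V := by
  rw [Finset.card_sigma, mul_comm]
  refine Finset.sum_le_card_nsmul _ _ _ fun x _ => ?_
  rw [Finset.card_product, Finset.card_sigma]
  have h1 : (insert x (nbrs H x)).card ≤ 4 :=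
    (Finset.card_insert_le _ _).trans (Nat.succ_le_succ (h.card_nbrs_le x))
  have h2 : ∑ y ∈ insert x (nbrs H x), (nbrs H y).card ≤ (insert x (nbrs H x)).card • 3 :=
    Finset.sum_le_card_nsmul _ _ _ fun y _ => h.card_nbrs_le y
  rw [smul_eq_mul] at h2
  calc _ ≤ 3 * (4 * 3) := Nat.mul_le_mul (h.card_nbrs_le x) (h2.trans (by omega))
    _ = 36 := rfl

theorem card_sigma_le_mul {α : Type*} {β : α → Type*} (s : Finset α) (t : ∀ a, Finset (β a)) (k : ℕ)
    (h : ∀ a ∈ s, (t a).card ≤ k) : (s.sigma t).card ≤ k * s.card := by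
  rw [Finset.card_sigma, mul_comm]
  exact Finset.sum_le_card_nsmul _ _ _ h

theorem mul_le_card_sigma {α : Type*} {β : α → Type*} (s : Finset α) (t : ∀ a, Finset (β a)) (k : ℕ)
    (h : ∀ a ∈ s, k ≤ (t a).card) : k * s.card ≤ (s.sigma t).card := by
  rw [Finset.card_sigma, mul_comm]
  exact Finset.card_nsmul_le_sum _ _ _ h

/-- `a` is joined to a vertex `b` that carries a loop. -/
def HasPendantLoop (E : Multiset (Sym2 V)) (a b : V) : Prop :=
  ∃ c d R, c ≠ a ∧ d ≠ a ∧ c ≠ b ∧ d ≠ b ∧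
    E = s(b, b) ::ₘ s(a, b) ::ₘ s(a, c) ::ₘ s(a, d) ::ₘ R

/-- `a` and `b` are joined by exactly two edges. -/
def HasDoubleEdge (E : Multiset (Sym2 V)) (a b : V) : Prop :=
  ∃ c d R, c ≠ a ∧ d ≠ a ∧ c ≠ b ∧ d ≠ b ∧
    E = s(a, b) ::ₘ s(a, b) ::ₘ s(a, c) ::ₘ s(b, d) ::ₘ R

/-- `x`, `a`, `b`, `y` is a path that closes up to a triangle or a quadrilateral. -/
def HasShortCycle (E : Multiset (Sym2 V)) (a b x y : V) : Prop :=
  ∃ c d R, c ≠ a ∧ d ≠ a ∧ c ≠ b ∧ d ≠ b ∧ x ≠ a ∧ y ≠ a ∧ x ≠ b ∧ y ≠ b ∧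
    (x = y ∨ s(x, y) ∈ R) ∧
    E = s(a, b) ::ₘ s(a, x) ::ₘ s(a, c) ::ₘ s(b, y) ::ₘ s(b, d) ::ₘ R

/-- The code of a graph is the result of `IsCubic.delete_loop` together with the new edge cd,
oriented; there are at most 3n orientations of edges up to multiplicity. -/
theorem card_hasPendantLoop_le {a b : V} (hab : a ≠ b) (S : Finset (Multiset (Sym2 V)))
    (hS : ∀ E ∈ S, IsCubic E ∧ HasPendantLoop E a b) :
    S.card ≤ 3 * Fintype.card V * (cubicOff a b).card := by
  refine le_trans ?_ (card_sigma_le_mul (cubicOff a b) (fun H => Finset.univ.sigma (nbrs H)) _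
    fun H hH => (mem_cubicOff.1 hH).card_darts_le)
  refine card_le_card_of_code (g := id)
    (fun t => s(b, b) ::ₘ s(a, b) ::ₘ s(a, t.2.1) ::ₘ s(a, t.2.2) ::ₘ t.1.erase s(t.2.1, t.2.2))
    Function.injective_id fun E hE => ?_
  obtain ⟨hE, c, d, R, hca, hda, hcb, hdb, rfl⟩ := hS E hE
  exact ⟨⟨s(c, d) ::ₘ R, c, d⟩,
    by simp [hE.delete_loop hab hca hda hcb hdb], by simp⟩

theorem card_hasDoubleEdge_le {a b : V} (hab : a ≠ b) (S : Finset (Multiset (Sym2 V)))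
    (hS : ∀ E ∈ S, IsCubic E ∧ HasDoubleEdge E a b) :
    S.card ≤ 3 * Fintype.card V * (cubicOff a b).card := by
  refine le_trans ?_ (card_sigma_le_mul (cubicOff a b) (fun H => Finset.univ.sigma (nbrs H)) _
    fun H hH => (mem_cubicOff.1 hH).card_darts_le)
  refine card_le_card_of_code (g := id)
    (fun t => s(a, b) ::ₘ s(a, b) ::ₘ s(a, t.2.1) ::ₘ s(b, t.2.2) ::ₘ t.1.erase s(t.2.1, t.2.2))
    Function.injective_id fun E hE => ?_
  obtain ⟨hE, c, d, R, hca, hda, hcb, hdb, rfl⟩ := hS E hE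
  exact ⟨⟨s(c, d) ::ₘ R, c, d⟩,
    by simp [hE.delete_double hab hca hda hcb hdb], by simp⟩

theorem card_hasShortCycle_le {a b : V} (hab : a ≠ b)
    (S : Finset (Multiset (Sym2 V) × V × V))
    (hS : ∀ t ∈ S, IsCubic t.1 ∧ HasShortCycle t.1 a b t.2.1 t.2.2) :
    S.card ≤ 36 * Fintype.card V * (cubicOff a b).card := by
  refine le_trans ?_ (card_sigma_le_mul (cubicOff a b)
    (fun H => Finset.univ.sigma fun x => nbrs H x ×ˢ (insert x (nbrs H x)).sigma (nbrs H)) _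
    fun H hH => (mem_cubicOff.1 hH).card_walks_le)
  refine card_le_card_of_code (g := id)
    (fun t => (s(a, b) ::ₘ s(a, t.2.1) ::ₘ s(a, t.2.2.1) ::ₘ s(b, t.2.2.2.1) ::ₘ
      s(b, t.2.2.2.2) ::ₘ (t.1.erase s(t.2.2.1, t.2.1)).erase s(t.2.2.2.2, t.2.2.2.1),
      t.2.1, t.2.2.2.1))
    Function.injective_id fun E hE => ?_
  obtain ⟨E, x, y⟩ := E
  obtain ⟨hE, c, d, R, hca, hda, hcb, hdb, hxa, hya, hxb, hyb, hxy, h⟩ := hS _ hE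
  simp only at h hE hca hda hcb hdb hxa hya hxb hyb hxy
  subst h
  refine ⟨⟨s(c, x) ::ₘ s(d, y) ::ₘ R, x, c, y, d⟩, ?_, by simp⟩
  have h1 : s(x, c) = s(c, x) := Sym2.eq_swap
  have h2 : s(y, d) = s(d, y) := Sym2.eq_swap
  have h3 : y = x ∨ s(x, y) ∈ R := hxy.imp_left Eq.symm
  simp only [Finset.mem_sigma, mem_cubicOff, Finset.mem_univ, true_and, Finset.mem_product,
    mem_nbrs, Finset.mem_insert, h1, h2, Multiset.mem_cons, true_or, or_true, and_true]
  refine ⟨hE.delete_edge hab hca hda hcb hdb hxa hya hxb hyb hxy, ?_⟩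
  tauto

/-- Double counting of triples (H, p, r) in which different edges pq and rt of H get subdivided.
Each H admits at least (n - 2)(n - 4) pairs (p, r); a triple is recovered from the resulting graph
and the neighbours p, q of a and r, t of b, which leave at most 3⁴ = 81 choices. -/
theorem mul_card_cubicOff_le {a b : V} (hab : a ≠ b) (S : Finset (Multiset (Sym2 V)))
    (hS : ∀ E, IsCubic E → s(a, b) ∈ E → E ∈ S) (hS' : ∀ E ∈ S, IsCubic E) :
    (Fintype.card V - 4) * (Fintype.card V - 2) * (cubicOff a b).card ≤ 81 * S.card := by
  classical
  set B : Multiset (Sym2 V) → V → Finset V := fun H p => Finset.univ.filter fun r =>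
    ∃ q t R, H = s(p, q) ::ₘ s(r, t) ::ₘ R with hB
  have hBcard : ∀ H ∈ cubicOff a b, ∀ p ∈ ({a, b} : Finset V)ᶜ,
      Fintype.card V - 4 ≤ (B H p).card := by
    intro H hH p hp
    rw [mem_cubicOff] at hH
    simp only [Finset.mem_compl, Finset.mem_insert, Finset.mem_singleton, not_or] at hp
    obtain ⟨q, R, rfl⟩ := exists_eq_cons_of_degree_pos
      (by rw [hH.degree_eq p hp.1 hp.2]; omega : 0 < multigraphDegree H p)
    -- As r avoids p and q, its degree is not affected by removing pq, so a second edge rt is left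
    -- in the rest.
    have hsub : ({a, b, p, q} : Finset V)ᶜ ⊆ B (s(p, q) ::ₘ R) p := by
      intro r hr
      simp only [Finset.mem_compl, Finset.mem_insert, Finset.mem_singleton, not_or] at hr
      obtain ⟨ha, hb, hpr, hqr⟩ := hr
      have h1 := hH.degree_eq r ha hb
      simp [Ne.symm hpr, Ne.symm hqr] at h1
      obtain ⟨t, R, rfl⟩ := exists_eq_cons_of_degree_pos
        (by omega : 0 < multigraphDegree R r)
      simp only [hB, Finset.mem_filter, Finset.mem_univ, true_and]
      exact ⟨q, t, R, rfl⟩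
    refine le_trans ?_ (Finset.card_le_card hsub)
    rw [Finset.card_compl]
    exact Nat.sub_le_sub_left Finset.card_le_four _
  have h1 : ∀ H ∈ cubicOff a b, (Fintype.card V - 4) * (Fintype.card V - 2) ≤
      (({a, b} : Finset V)ᶜ.sigma (B H)).card := by
    intro H hH
    refine le_trans ?_ (mul_le_card_sigma _ _ _ (hBcard H hH))
    refine Nat.mul_le_mul_left _ ?_
    rw [Finset.card_compl]
    exact Nat.sub_le_sub_left Finset.card_le_two _
  refine (mul_le_card_sigma _ _ _ h1).trans ?_
  refine le_trans ?_ (card_sigma_le_mul S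
    (fun E => (nbrs E a ×ˢ nbrs E a) ×ˢ (nbrs E b ×ˢ nbrs E b)) 81 fun E hE => ?_)
  · refine card_le_card_of_code (g := id)
      (fun t => ⟨s(t.2.1.1, t.2.1.2) ::ₘ s(t.2.2.1, t.2.2.2) ::ₘ
        ((((t.1.erase s(a, b)).erase s(t.2.1.1, a)).erase s(t.2.1.2, a)).erase
          s(t.2.2.1, b)).erase s(t.2.2.2, b), t.2.1.1, t.2.2.1⟩)
      Function.injective_id ?_
    rintro ⟨H, p, r⟩ h
    simp only [Finset.mem_sigma, mem_cubicOff, hB, Finset.mem_filter, Finset.mem_univ,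
      true_and] at h
    obtain ⟨hH, -, q, t, R, rfl⟩ := h
    have hE := hH.isCubic_insert hab
    refine ⟨⟨s(a, b) ::ₘ s(p, a) ::ₘ s(q, a) ::ₘ s(r, b) ::ₘ s(t, b) ::ₘ R, (p, q), (r, t)⟩,
      ?_, ?_⟩
    · simp only [Finset.mem_sigma, Finset.mem_product, mem_nbrs]
      refine ⟨hS _ hE (by simp), ?_⟩
      rw [Sym2.eq_swap (a := a) (b := p), Sym2.eq_swap (a := a) (b := q),
        Sym2.eq_swap (a := b) (b := r), Sym2.eq_swap (a := b) (b := t)]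
      simp
    · simp
  · have ha := (hS' E hE).card_nbrs_le a
    have hb := (hS' E hE).card_nbrs_le b
    simp only [Finset.card_product]
    calc _ ≤ 3 * 3 * (3 * 3) := Nat.mul_le_mul (Nat.mul_le_mul ha ha) (Nat.mul_le_mul hb hb)
      _ = 81 := rfl

end Off

/-! ### Paths of length three and their obstructions. -/

section Paths

variable {V : Type*} [DecidableEq V] [Fintype V]

/-- A vertex with a loop or a multiple edge. -/
def IsDefective (E : Multiset (Sym2 V)) (u : V) : Prop :=
  s(u, u) ∈ E ∨ ∃ v, v ≠ u ∧ 2 ≤ E.count s(u, v)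

omit [Fintype V] in
theorem not_isDefective_ne {u v : V} {E : Multiset (Sym2 V)} (h : ¬ IsDefective E u)
    (hv : s(u, v) ∈ E) : v ≠ u := by
  rintro rfl; exact h (Or.inl hv)

omit [Fintype V] in
theorem not_isDefective_notMem {u v : V} {R : Multiset (Sym2 V)}
    (h : ¬ IsDefective (s(u, v) ::ₘ R) u) : s(u, v) ∉ R := by
  intro hR
  refine h (Or.inr ⟨v, not_isDefective_ne h (by simp), ?_⟩)
  rw [Multiset.count_cons_self]
  have := Multiset.count_pos.2 hR
  omega

theorem IsCubic.card_nbrs {E : Multiset (Sym2 V)} (h : IsCubic E) {u : V}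
    (hu : ¬ IsDefective E u) : (nbrs E u).card = 3 := by
  refine le_antisymm (h.card_nbrs_le u) ?_
  have hd := h.degree_eq u
  obtain ⟨p, R, rfl⟩ := exists_eq_cons_of_degree_pos (by omega : 0 < multigraphDegree E u)
  have hp := not_isDefective_ne (v := p) hu (by simp)
  have hpR := not_isDefective_notMem hu
  simp [hp] at hd
  obtain ⟨q, R, rfl⟩ := exists_eq_cons_of_degree_pos (by omega : 0 < multigraphDegree R u)
  have hq := not_isDefective_ne (v := q) hu (by simp)
  rw [Multiset.cons_swap] at hu
  have hqR := not_isDefective_notMem hu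
  simp [hq] at hd
  obtain ⟨r, R, rfl⟩ := exists_eq_cons_of_degree_pos (by omega : 0 < multigraphDegree R u)
  have hsub : ({p, q, r} : Finset V) ⊆ nbrs (s(u, p) ::ₘ s(u, q) ::ₘ s(u, r) ::ₘ R) u := by
    intro w; simp; tauto
  refine le_trans (le_of_eq ?_) (Finset.card_le_card hsub)
  symm
  rw [Finset.card_eq_three]
  refine ⟨p, q, r, ?_, ?_, ?_, rfl⟩
  · rintro rfl; simp at hpR
  · rintro rfl; simp at hpR
  · rintro rfl; simp at hqR

open Classical in
/-- The finset of vertices that carry a loop or a multiple edge. -/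
noncomputable def defects (E : Multiset (Sym2 V)) : Finset V :=
  Finset.univ.filter (IsDefective E)

@[simp]
theorem mem_defects {E : Multiset (Sym2 V)} {u : V} : u ∈ defects E ↔ IsDefective E u := by
  simp [defects]

-- Each defective vertex is charged to an ordered pair: a vertex with a loop is the second entry, an
-- end of a double edge the first. Having three vertices excludes the graphs of order 2, where these
-- configurations degenerate.
open Classical in
theorem IsCubic.card_defects_le {E : Multiset (Sym2 V)} (h : IsCubic E)
    (hV : 3 ≤ Fintype.card V) :
    (defects E).card ≤
      ((Finset.univ : Finset V).offDiag.filter fun p => HasPendantLoop E p.1 p.2).card +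
      ((Finset.univ : Finset V).offDiag.filter fun p => HasDoubleEdge E p.1 p.2).card := by
  have hV' : ∀ a b : V, ∃ z, z ≠ a ∧ z ≠ b := by
    intro a b
    have : ({a, b} : Finset V).card < (Finset.univ : Finset V).card :=
      lt_of_le_of_lt Finset.card_le_two (by rw [Finset.card_univ]; omega)
    obtain ⟨z, -, hz⟩ := Finset.exists_mem_notMem_of_card_lt_card this
    simp at hz
    exact ⟨z, hz⟩
  have hsub : defects E ⊆
      ((Finset.univ : Finset V).offDiag.filter fun p => HasPendantLoop E p.1 p.2).image Prod.snd ∪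
      ((Finset.univ : Finset V).offDiag.filter fun p => HasDoubleEdge E p.1 p.2).image
        Prod.fst := by
    intro u hu
    rw [mem_defects] at hu
    rw [Finset.mem_union]
    rcases hu with hu | ⟨v, hvu, hv⟩
    · obtain ⟨a, c, d, R, hab, h'⟩ := h.exists_of_loop hu fun a => hV' a u
      exact Or.inl (Finset.mem_image.2 ⟨(a, u), by simpa using ⟨hab, c, d, R, h'⟩, rfl⟩)
    · obtain ⟨c, d, R, h'⟩ := h.exists_of_double hvu.symm hv (hV' u v)
      exact Or.inr (Finset.mem_image.2 ⟨(u, v), by simpa using ⟨hvu.symm, c, d, R, h'⟩, rfl⟩)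
  refine (Finset.card_le_card hsub).trans ((Finset.card_union_le _ _).trans ?_)
  exact Nat.add_le_add Finset.card_image_le Finset.card_image_le

/-- The ordered pairs of adjacent vertices without loops and multiple edges. -/
noncomputable def links (E : Multiset (Sym2 V)) : Finset (Σ _ : V, V) :=
  (defects E)ᶜ.sigma fun u => nbrs E u \ defects E

/-- The paths `x`, `u`, `v`, `y` of length three, given as `⟨⟨u, v⟩, (x, y)⟩`, whose inner
vertices do not carry loops or multiple edges; `x = y` is allowed. -/
noncomputable def paths (E : Multiset (Sym2 V)) : Finset (Σ _ : Σ _ : V, V, V × V) :=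
  (links E).sigma fun l => (nbrs E l.1).erase l.2 ×ˢ (nbrs E l.2).erase l.1

theorem mem_paths {E : Multiset (Sym2 V)} {u v x y : V} :
    (⟨⟨u, v⟩, (x, y)⟩ : Σ _ : Σ _ : V, V, V × V) ∈ paths E ↔
      ((¬ IsDefective E u ∧ s(u, v) ∈ E ∧ ¬ IsDefective E v) ∧
        (x ≠ v ∧ s(u, x) ∈ E) ∧ y ≠ u ∧ s(v, y) ∈ E) := by
  simp [paths, links]

/-- The non-defective vertices start 3(n - d) ordered adjacencies, where d is the number of defects.
Those ending in a defect are, reversed, among the at most 3d that start there. -/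
theorem IsCubic.le_card_links {E : Multiset (Sym2 V)} (h : IsCubic E) :
    3 * Fintype.card V ≤ (links E).card + 6 * (defects E).card := by
  have h1 : 3 * (defects E)ᶜ.card ≤ ((defects E)ᶜ.sigma (nbrs E)).card :=
    mul_le_card_sigma _ _ _ fun u hu =>
      (h.card_nbrs (by simpa using hu)).ge
  have h2 : ((defects E).sigma (nbrs E)).card ≤ 3 * (defects E).card :=
    card_sigma_le_mul _ _ _ fun u _ => h.card_nbrs_le u
  have h3 : (defects E)ᶜ.sigma (nbrs E) ⊆
      links E ∪ ((defects E).sigma (nbrs E)).image fun l => ⟨l.2, l.1⟩ := by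
    rintro ⟨u, v⟩ huv
    simp only [Finset.mem_sigma, Finset.mem_compl, mem_nbrs] at huv
    rw [Finset.mem_union, links, Finset.mem_sigma]
    by_cases hv : v ∈ defects E
    · right
      exact Finset.mem_image.2 ⟨⟨v, u⟩, by
        simp only [Finset.mem_sigma, mem_nbrs]
        exact ⟨hv, by rw [Sym2.eq_swap]; exact huv.2⟩, rfl⟩
    · left
      simp only [Finset.mem_compl, Finset.mem_sdiff, mem_nbrs]
      exact ⟨huv.1, huv.2, hv⟩
  have h4 := (Finset.card_le_card h3).trans (Finset.card_union_le _ _)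
  have h5 := Finset.card_image_le (s := (defects E).sigma (nbrs E))
    (f := fun l => (⟨l.2, l.1⟩ : Σ _ : V, V))
  have h6 := Finset.card_add_card_compl (defects E)
  omega

/-- Both ends of a link have exactly three neighbours, so there are 2 · 2 ways to extend it. -/
theorem IsCubic.le_card_paths {E : Multiset (Sym2 V)} (h : IsCubic E) :
    4 * (links E).card ≤ (paths E).card := by
  refine mul_le_card_sigma _ _ _ ?_
  rintro ⟨u, v⟩ hl
  simp only [links, Finset.mem_sigma, Finset.mem_compl, Finset.mem_sdiff, mem_defects,
    mem_nbrs] at hl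
  obtain ⟨hu, huv, hv⟩ := hl
  simp only [Finset.card_product]
  rw [Finset.card_erase_of_mem (by simpa using huv),
    Finset.card_erase_of_mem (by simpa [Sym2.eq_swap (a := v)] using huv),
    h.card_nbrs hu, h.card_nbrs hv]

omit [Fintype V] in
theorem IsCubic.hasShortCycle {E : Multiset (Sym2 V)} (h : IsCubic E) {u v x y : V}
    (hu : ¬ IsDefective E u) (huv : s(u, v) ∈ E) (hv : ¬ IsDefective E v)
    (hxv : x ≠ v) (hux : s(u, x) ∈ E) (hyu : y ≠ u) (hvy : s(v, y) ∈ E)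
    (hxy : x = y ∨ s(x, y) ∈ E) : HasShortCycle E u v x y := by
  have hvu := not_isDefective_ne hu huv
  have hxu := not_isDefective_ne hu hux
  have hyv := not_isDefective_ne hv hvy
  have hdu := h.degree_eq u
  have hdv := h.degree_eq v
  obtain ⟨R, rfl⟩ := Multiset.exists_cons_of_mem huv
  have huv' := not_isDefective_notMem hu
  have hux' : s(u, x) ∈ R := by
    simpa [hxv, hxu] using hux
  obtain ⟨R, rfl⟩ := Multiset.exists_cons_of_mem hux'
  simp [hvu, hvu.symm, hxu, hxv] at hdu hdv
  obtain ⟨c, R, rfl⟩ := exists_eq_cons_of_degree_pos (by omega : 0 < multigraphDegree R u)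
  have hcu := not_isDefective_ne (v := c) hu (by simp)
  have hcv : c ≠ v := by rintro rfl; simp at huv'
  have hvy' : s(v, y) ∈ R := by
    simpa [hvu, hyu, hxv.symm, hcv.symm] using hvy
  simp [hvu.symm, hcu, hcv] at hdu hdv
  obtain ⟨R, rfl⟩ := Multiset.exists_cons_of_mem hvy'
  simp [hyu, hyv, hvu] at hdu hdv
  obtain ⟨d, R, rfl⟩ := exists_eq_cons_of_degree_pos (by omega : 0 < multigraphDegree R v)
  have hdv' := not_isDefective_ne (v := d) hv (by simp)
  have hdu' : d ≠ u := by
    rintro rfl; simp [hvu] at hdu; omega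
  refine ⟨c, d, R, hcu, hdu', hcv, hdv', hxu, hyu, hxv, hyv, hxy.imp_right fun hm => ?_, rfl⟩
  -- The five edges split off all meet u or v, while x and y avoid both, so xy lies in the rest.
  simpa [hxu, hxv, hyu, hyv] using hm

open Classical in
theorem IsCubic.card_short_paths_le {E : Multiset (Sym2 V)} (h : IsCubic E) :
    ((paths E).filter fun t => ¬ (t.2.1 ≠ t.2.2 ∧ s(t.2.1, t.2.2) ∉ E)).card ≤
      ∑ p ∈ (Finset.univ : Finset V).offDiag,
        (Finset.univ.filter fun q : V × V => HasShortCycle E p.1 p.2 q.1 q.2).card := by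
  rw [← Finset.card_sigma]
  refine card_le_card_of_code (g := id) (fun t => ⟨⟨t.1.1, t.1.2⟩, t.2⟩) Function.injective_id ?_
  rintro ⟨⟨u, v⟩, x, y⟩ ht
  rw [Finset.mem_filter, mem_paths] at ht
  obtain ⟨⟨⟨hu, huv, hv⟩, ⟨hxv, hux⟩, hyu, hvy⟩, hxy⟩ := ht
  refine ⟨⟨(u, v), (x, y)⟩, ?_, rfl⟩
  simp only [Finset.mem_sigma, Finset.mem_offDiag, Finset.mem_univ, true_and, Finset.mem_filter]
  refine ⟨(not_isDefective_ne hu huv).symm, h.hasShortCycle hu huv hv hxv hux hyu hvy ?_⟩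
  simp only at hxy
  tauto

theorem IsCubic.le_card_long_paths {E : Multiset (Sym2 V)} (h : IsCubic E) :
    12 * Fintype.card V ≤ 24 * (defects E).card +
      ((paths E).filter fun t => t.2.1 ≠ t.2.2 ∧ s(t.2.1, t.2.2) ∉ E).card +
      ((paths E).filter fun t => ¬ (t.2.1 ≠ t.2.2 ∧ s(t.2.1, t.2.2) ∉ E)).card := by
  have h1 := h.le_card_links
  have h2 := h.le_card_paths
  have h3 := Finset.card_filter_add_card_filter_not (s := paths E)
    (fun t => t.2.1 ≠ t.2.2 ∧ s(t.2.1, t.2.2) ∉ E)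
  omega

/-! ### Different paths give different neighbours. -/

/-- The result of the Whitehead move along a path `x`, `u`, `v`, `y`. -/
def moveAlong (E : Multiset (Sym2 V)) (t : Σ _ : Σ _ : V, V, V × V) : Multiset (Sym2 V) :=
  s(t.1.2, t.2.1) ::ₘ s(t.1.1, t.2.2) ::ₘ (E.erase s(t.1.1, t.2.1)).erase s(t.1.2, t.2.2)

theorem moveAlong_spec {E : Multiset (Sym2 V)} {u v x y : V}
    (ht : (⟨⟨u, v⟩, (x, y)⟩ : Σ _ : Σ _ : V, V, V × V) ∈ paths E) :
    ∃ R, E = s(u, v) ::ₘ s(u, x) ::ₘ s(v, y) ::ₘ R ∧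
      moveAlong E ⟨⟨u, v⟩, (x, y)⟩ = s(u, v) ::ₘ s(v, x) ::ₘ s(u, y) ::ₘ R ∧
      v ≠ u ∧ x ≠ u ∧ x ≠ v ∧ y ≠ u ∧ y ≠ v := by
  rw [mem_paths] at ht
  obtain ⟨⟨hu, huv, hv⟩, ⟨hxv, hux⟩, hyu, hvy⟩ := ht
  have hvu := not_isDefective_ne hu huv
  have hxu := not_isDefective_ne hu hux
  have hyv := not_isDefective_ne hv hvy
  obtain ⟨R, rfl⟩ := Multiset.exists_cons_of_mem huv
  have hux' : s(u, x) ∈ R := by simpa [hxv, hxu] using hux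
  obtain ⟨R, rfl⟩ := Multiset.exists_cons_of_mem hux'
  have hvy' : s(v, y) ∈ R := by simpa [hvu, hyu, hxv.symm] using hvy
  obtain ⟨R, rfl⟩ := Multiset.exists_cons_of_mem hvy'
  refine ⟨R, rfl, ?_, hvu, hxu, hxv, hyu, hyv⟩
  have h1 : s(u, v) ::ₘ s(u, x) ::ₘ s(v, y) ::ₘ R = s(u, x) ::ₘ s(v, y) ::ₘ s(u, v) ::ₘ R := by
    rw [Multiset.cons_swap, Multiset.cons_swap (s(u, v))]
  simp only [moveAlong]
  rw [h1, Multiset.erase_cons_head, Multiset.erase_cons_head, Multiset.cons_swap s(u, y),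
    Multiset.cons_swap s(v, x)]

/-- Since x ≠ y, no removed edge is put back, so the edges that lose and gain multiplicity can be
read off from the result. This fixes the removed and added edges. The one remaining ambiguity is the
quadrilateral: along u, x, y, v the move has the same effect, with inner edge xy. The hypothesis
`hE` rules it out. -/
theorem moveAlong_eq {E : Multiset (Sym2 V)} {u v x y u' v' x' y' : V}
    (ht : (⟨⟨u, v⟩, (x, y)⟩ : Σ _ : Σ _ : V, V, V × V) ∈ paths E) (hxy : x ≠ y)
    (ht' : (⟨⟨u', v'⟩, (x', y')⟩ : Σ _ : Σ _ : V, V, V × V) ∈ paths E) (hxy' : x' ≠ y')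
    (hE : s(x, y) ∉ E)
    (h : moveAlong E ⟨⟨u, v⟩, (x, y)⟩ = moveAlong E ⟨⟨u', v'⟩, (x', y')⟩) :
    (u' = u ∧ v' = v ∧ x' = x ∧ y' = y) ∨ (u' = v ∧ v' = u ∧ x' = y ∧ y' = x) := by
  have huv' : s(u', v') ∈ E := (mem_paths.1 ht').1.2.1
  obtain ⟨R, h1, h2, hvu, hxu, hxv, hyu, hyv⟩ := moveAlong_spec ht
  obtain ⟨R', h1', h2', hvu', hxu', hxv', hyu', hyv'⟩ := moveAlong_spec ht'
  rw [h2, h2'] at h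
  have hc : ∀ e : Sym2 V, E.count e = (if e = s(u, v) then 1 else 0) +
      (if e = s(u, x) then 1 else 0) + (if e = s(v, y) then 1 else 0) + R.count e := by
    intro e; rw [h1]; simp only [Multiset.count_cons]; omega
  have hc' : ∀ e : Sym2 V, E.count e = (if e = s(u', v') then 1 else 0) +
      (if e = s(u', x') then 1 else 0) + (if e = s(v', y') then 1 else 0) + R'.count e := by
    intro e; rw [h1']; simp only [Multiset.count_cons]; omega
  have hc2 : ∀ e : Sym2 V, (if e = s(u, v) then 1 else 0) +
      (if e = s(v, x) then 1 else 0) + (if e = s(u, y) then 1 else 0) + R.count e =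
      (if e = s(u', v') then 1 else 0) +
      (if e = s(v', x') then 1 else 0) + (if e = s(u', y') then 1 else 0) + R'.count e := by
    intro e
    have := congrArg (Multiset.count e) h
    simp only [Multiset.count_cons] at this; omega
  have k1 : s(u', x') = s(u, x) ∨ s(u', x') = s(v, y) := by
    by_contra! hn
    have e1 := hc s(u', x'); have e2 := hc' s(u', x'); have e3 := hc2 s(u', x')
    have n1 : s(u', x') ≠ s(v', x') := by simp [hvu'.symm, hxv']
    have n2 : s(u', x') ≠ s(u', y') := by simp [hxy', hxu']
    rw [if_neg hn.1, if_neg hn.2] at e1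
    rw [if_pos rfl] at e2
    rw [if_neg n1, if_neg n2] at e3
    omega
  have k2 : s(v', y') = s(u, x) ∨ s(v', y') = s(v, y) := by
    by_contra! hn
    have e1 := hc s(v', y'); have e2 := hc' s(v', y'); have e3 := hc2 s(v', y')
    have n1 : s(v', y') ≠ s(v', x') := by simp [hxy'.symm, hxv'.symm]
    have n2 : s(v', y') ≠ s(u', y') := by simp [hvu', hyu']
    rw [if_neg hn.1, if_neg hn.2] at e1
    rw [if_pos (rfl : s(v', y') = s(v', y'))] at e2
    rw [if_neg n1, if_neg n2] at e3
    omega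
  have k3 : s(v', x') = s(v, x) ∨ s(v', x') = s(u, y) := by
    by_contra! hn
    have e1 := hc s(v', x'); have e2 := hc' s(v', x'); have e3 := hc2 s(v', x')
    have n1 : s(v', x') ≠ s(u', x') := by simp [hvu', hxv'.symm]
    have n2 : s(v', x') ≠ s(v', y') := by simp [hxy', hxv']
    rw [if_neg hn.1, if_neg hn.2, if_pos (rfl : s(v', x') = s(v', x'))] at e3
    rw [if_neg n1, if_neg n2] at e2
    omega
  have hE' : s(u', v') ≠ s(x, y) := fun h' => hE (h' ▸ huv')
  simp only [ne_eq, Sym2.eq_iff] at k1 k2 k3 hE'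
  grind

theorem card_long_paths_le {E : Multiset (Sym2 V)} (T : Finset (Multiset (Sym2 V)))
    (hT : ∀ (u v x y : V) (R : Multiset (Sym2 V)), v ≠ u → x ≠ u → x ≠ v → y ≠ u → y ≠ v → x ≠ y →
      E = s(u, v) ::ₘ s(u, x) ::ₘ s(v, y) ::ₘ R → s(u, v) ::ₘ s(v, x) ::ₘ s(u, y) ::ₘ R ∈ T) :
    ((paths E).filter fun t => t.2.1 ≠ t.2.2 ∧ s(t.2.1, t.2.2) ∉ E).card ≤ 2 * T.card := by
  refine Finset.card_le_mul_card_image_of_maps_to (f := moveAlong E) ?_ 2 ?_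
  · rintro ⟨⟨u, v⟩, x, y⟩ ht
    rw [Finset.mem_filter] at ht
    obtain ⟨R, h1, h2, hvu, hxu, hxv, hyu, hyv⟩ := moveAlong_spec ht.1
    rw [h2]
    exact hT u v x y R hvu hxu hxv hyu hyv ht.2.1 h1
  · intro F _
    rcases Finset.eq_empty_or_nonempty (((paths E).filter fun t => t.2.1 ≠ t.2.2 ∧
      s(t.2.1, t.2.2) ∉ E).filter fun t => moveAlong E t = F) with h0 | ⟨⟨⟨u, v⟩, x, y⟩, ht⟩
    · rw [h0]; simp
    · rw [Finset.mem_filter, Finset.mem_filter] at ht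
      refine (Finset.card_le_card (t := {⟨⟨u, v⟩, x, y⟩, ⟨⟨v, u⟩, y, x⟩}) ?_).trans
        Finset.card_le_two
      rintro ⟨⟨u', v'⟩, x', y'⟩ ht'
      rw [Finset.mem_filter, Finset.mem_filter] at ht'
      have := moveAlong_eq ht.1.1 ht.1.2.1 ht'.1.1 ht'.1.2.1 ht.1.2.2 (ht.2.trans ht'.2.symm)
      rw [Finset.mem_insert, Finset.mem_singleton]
      rcases this with ⟨rfl, rfl, rfl, rfl⟩ | ⟨rfl, rfl, rfl, rfl⟩
      · left; rfl
      · right; rfl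

end Paths

/-! ### Existence of labelled cubic graphs of every even order. -/

section MoebiusLadder

theorem multigraphDegree_map {ι V : Type*} [DecidableEq V] (S : Finset ι) (f g : ι → V) (v : V) :
    multigraphDegree (S.val.map fun i => s(f i, g i)) v =
      ∑ i ∈ S, ((if f i = v then 1 else 0) + (if g i = v then 1 else 0)) := by
  rw [Finset.sum]
  induction S.val using Multiset.induction with
  | empty => simp
  | cons i R ih => simp [ih]

/-- The Möbius ladder: a cycle together with the edges joining antipodal vertices. -/
theorem nonempty_labelledCubicGraph {n : ℕ} (hn : 0 < n) (he : Even n) :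
    Nonempty (LabelledCubicGraph n) := by
  obtain ⟨m, hm⟩ := he
  obtain ⟨k, rfl⟩ : ∃ k, n = k + 1 := ⟨n - 1, by omega⟩
  have hj (j : Fin m) : (j : ℕ) < k + 1 := by have := j.2; omega
  have hjm (j : Fin m) : (j : ℕ) + m < k + 1 := by have := j.2; omega
  set C : Multiset (Sym2 (Fin (k + 1))) :=
    (Finset.univ : Finset (Fin (k + 1))).val.map fun i => s(i, i + 1) with hC
  set M : Multiset (Sym2 (Fin (k + 1))) := (Finset.univ : Finset (Fin m)).val.map
    fun j : Fin m => s((⟨j, hj j⟩ : Fin (k + 1)), (⟨j + m, hjm j⟩ : Fin (k + 1))) with hM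
  refine ⟨⟨C + M, fun v => ?_, ?_⟩⟩
  · rw [multigraphDegree_add, hC, hM, multigraphDegree_map, multigraphDegree_map]
    have h1 : ∀ i : Fin (k + 1), (i + 1 = v) = (i = v - 1) := fun i =>
      propext eq_sub_iff_add_eq.symm
    -- Every vertex v lies on exactly one rung, with index v or v - m.
    have h2 : ∀ j : Fin m, ((if (⟨j, hj j⟩ : Fin (k + 1)) = v then 1 else 0) +
        (if (⟨j + m, hjm j⟩ : Fin (k + 1)) = v then 1 else 0)) =
        if j = (⟨if v.1 < m then v else v - m, by split_ifs <;> omega⟩ : Fin m) then 1 else 0 := by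
      intro j
      have := j.2
      simp only [Fin.ext_iff]
      split_ifs <;> omega
    rw [Finset.sum_congr rfl fun j _ => h2 j]
    simp [Finset.sum_add_distrib, h1]
  · have h0 : ∀ i : Fin (k + 1), (edgeGraph (C + M)).Reachable 0 i := by
      intro i
      induction i using Fin.induction with
      | zero => rfl
      | succ i ih =>
        refine ih.trans (reachable_of_mem ?_)
        rw [Multiset.mem_add]
        left
        rw [hC, Multiset.mem_map]
        exact ⟨i.castSucc, by simp, by rw [Fin.coeSucc_eq_succ]⟩
    exact ⟨fun i j => (h0 i).symm.trans (h0 j)⟩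

end MoebiusLadder

/-! ### Summing over all labelled cubic graphs. -/

section Average

variable {n : ℕ}

theorem LabelledCubicGraph.isCubic (G : LabelledCubicGraph n) : IsCubic G.edges :=
  ⟨G.degree_eq, G.connected⟩

theorem LabelledCubicGraph.edges_injective :
    Function.Injective (LabelledCubicGraph.edges (n := n)) :=
  fun _ _ h => LabelledCubicGraph.ext h

open Classical in
theorem LabelledCubicGraph.card_long_paths_le (G : LabelledCubicGraph n) :
    ((paths G.edges).filter fun t => t.2.1 ≠ t.2.2 ∧ s(t.2.1, t.2.2) ∉ G.edges).card ≤
      2 * (whiteheadGraph n).degree G := by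
  rw [← SimpleGraph.card_neighborFinset_eq_degree,
    ← Finset.card_image_of_injective _ LabelledCubicGraph.edges_injective]
  refine _root_.card_long_paths_le _ fun u v x y R hvu hxu hxv hyu hyv hxy hE => ?_
  have hF := (hE ▸ G.isCubic : IsCubic _).whitehead
  refine Finset.mem_image.2 ⟨⟨_, hF.degree_eq, hF.connected⟩, ?_, rfl⟩
  rw [SimpleGraph.mem_neighborFinset]
  have h1 : s(u, v) ::ₘ s(u, x) ::ₘ s(v, y) ::ₘ R =
      {s(u, x), s(v, y)} + (s(u, v) ::ₘ R) := by
    simp only [Multiset.insert_eq_cons, Multiset.cons_add, Multiset.singleton_add]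
    rw [Multiset.cons_swap, Multiset.cons_swap s(u, v)]
  refine ⟨fun h => ?_, u, v, x, y, hvu.symm, ?_, ?_⟩
  -- The move changes the graph: one copy of ux is lost and neither new edge restores it.
  · have h2 := congrArg (fun G => Multiset.count s(u, x) (LabelledCubicGraph.edges G)) h
    simp only [hE, Multiset.count_cons] at h2
    have n1 : s(u, x) ≠ s(v, y) := by simp [hvu.symm, hyu.symm]
    have n2 : s(u, x) ≠ s(v, x) := by simp [hvu.symm, hxu.symm]
    have n3 : s(u, x) ≠ s(u, y) := by simp [hxy, hxu]
    rw [if_neg n1, if_neg n2, if_neg n3, if_true] at h2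
    omega
  · rw [hE]
    simp only [Multiset.insert_eq_cons, Multiset.cons_le_cons_iff]
    simp [← Multiset.cons_zero]
  · rw [hE, h1, add_tsub_cancel_left]
    simp only [Multiset.insert_eq_cons, Multiset.cons_add]
    rw [add_comm]
    simp

open Classical in
theorem LabelledCubicGraph.le_degree (hn : 3 ≤ n) (G : LabelledCubicGraph n) :
    12 * n ≤ 24 *
      (((Finset.univ : Finset (Fin n)).offDiag.filter fun p =>
        HasPendantLoop G.edges p.1 p.2).card +
      ((Finset.univ : Finset (Fin n)).offDiag.filter fun p =>
        HasDoubleEdge G.edges p.1 p.2).card) +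
      ∑ p ∈ (Finset.univ : Finset (Fin n)).offDiag, (Finset.univ.filter
        fun q : Fin n × Fin n => HasShortCycle G.edges p.1 p.2 q.1 q.2).card +
      2 * (whiteheadGraph n).degree G := by
  have h1 := G.isCubic.le_card_long_paths
  have h2 := G.isCubic.card_short_paths_le
  have h3 := G.card_long_paths_le
  have h4 := G.isCubic.card_defects_le (by simpa using hn)
  rw [Fintype.card_fin] at h1
  omega

/-- The number of triples of a pair `(a, b)` of distinct vertices and a multigraph that is cubic
and connected off `{a, b}`. -/
noncomputable def totalCubicOff (n : ℕ) : ℕ :=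
  ∑ p ∈ (Finset.univ : Finset (Fin n)).offDiag, (cubicOff p.1 p.2).card

theorem sum_card_filter_comm {α β : Type*} (s : Finset α) (t : Finset β) (r : α → β → Prop)
    [∀ a, DecidablePred (r a)] [∀ b, DecidablePred fun a => r a b] :
    ∑ a ∈ s, (t.filter fun b => r a b).card = ∑ b ∈ t, (s.filter fun a => r a b).card :=
  Finset.sum_card_bipartiteAbove_eq_sum_card_bipartiteBelow r

theorem totalCubicOff_mul_eq (k : ℕ) : k * totalCubicOff n =
    ∑ p ∈ (Finset.univ : Finset (Fin n)).offDiag, k * (cubicOff p.1 p.2).card :=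
  Finset.mul_sum _ _ _

open Classical in
theorem sum_hasPendantLoop_le : ∑ G : LabelledCubicGraph n,
    ((Finset.univ : Finset (Fin n)).offDiag.filter fun p =>
        HasPendantLoop G.edges p.1 p.2).card ≤ 3 * n * totalCubicOff n := by
  rw [sum_card_filter_comm, totalCubicOff_mul_eq]
  refine Finset.sum_le_sum fun p hp => ?_
  rw [← Finset.card_image_of_injective _ LabelledCubicGraph.edges_injective]
  have := card_hasPendantLoop_le (Finset.mem_offDiag.1 hp).2.2
    (Finset.image LabelledCubicGraph.edges
      (Finset.univ.filter fun G : LabelledCubicGraph n => HasPendantLoop G.edges p.1 p.2)) ?_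
  · rwa [Fintype.card_fin] at this
  · intro E hE
    obtain ⟨G, hG, rfl⟩ := Finset.mem_image.1 hE
    exact ⟨G.isCubic, (Finset.mem_filter.1 hG).2⟩

open Classical in
theorem sum_hasDoubleEdge_le : ∑ G : LabelledCubicGraph n,
    ((Finset.univ : Finset (Fin n)).offDiag.filter fun p =>
        HasDoubleEdge G.edges p.1 p.2).card ≤ 3 * n * totalCubicOff n := by
  rw [sum_card_filter_comm, totalCubicOff_mul_eq]
  refine Finset.sum_le_sum fun p hp => ?_
  rw [← Finset.card_image_of_injective _ LabelledCubicGraph.edges_injective]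
  have := card_hasDoubleEdge_le (Finset.mem_offDiag.1 hp).2.2
    (Finset.image LabelledCubicGraph.edges
      (Finset.univ.filter fun G : LabelledCubicGraph n => HasDoubleEdge G.edges p.1 p.2)) ?_
  · rwa [Fintype.card_fin] at this
  · intro E hE
    obtain ⟨G, hG, rfl⟩ := Finset.mem_image.1 hE
    exact ⟨G.isCubic, (Finset.mem_filter.1 hG).2⟩

open Classical in
theorem sum_hasShortCycle_le : ∑ G : LabelledCubicGraph n,
    ∑ p ∈ (Finset.univ : Finset (Fin n)).offDiag, (Finset.univ.filter
        fun q : Fin n × Fin n => HasShortCycle G.edges p.1 p.2 q.1 q.2).card ≤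
    36 * n * totalCubicOff n := by
  rw [Finset.sum_comm, totalCubicOff_mul_eq]
  refine Finset.sum_le_sum fun p hp => ?_
  rw [← Finset.card_sigma]
  have hinj : Function.Injective fun t : Σ _ : LabelledCubicGraph n, Fin n × Fin n =>
      (t.1.edges, t.2) := by
    rintro ⟨G, q⟩ ⟨G', q'⟩ h
    obtain ⟨h1, rfl⟩ := Prod.mk.inj h
    obtain rfl := LabelledCubicGraph.edges_injective h1
    rfl
  rw [← Finset.card_image_of_injective _ hinj]
  refine (card_hasShortCycle_le (Finset.mem_offDiag.1 hp).2.2 _ ?_).trans_eq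
    (by rw [Fintype.card_fin])
  intro t ht
  obtain ⟨⟨G, q⟩, hG, rfl⟩ := Finset.mem_image.1 ht
  exact ⟨G.isCubic, (Finset.mem_filter.1 (Finset.mem_sigma.1 hG).2).2⟩

-- The insertion count is summed over ordered pairs (a, b); a cubic graph contains at most 3n of
-- them as edges, and 81 · 3 = 243.
open Classical in
theorem mul_totalCubicOff_le :
    (n - 4) * (n - 2) * totalCubicOff n ≤ 243 * n * Fintype.card (LabelledCubicGraph n) := by
  have h1 : (n - 4) * (n - 2) * totalCubicOff n ≤
      ∑ p ∈ (Finset.univ : Finset (Fin n)).offDiag, 81 *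
        (Finset.univ.filter fun G : LabelledCubicGraph n => s(p.1, p.2) ∈ G.edges).card := by
    rw [totalCubicOff_mul_eq]
    refine Finset.sum_le_sum fun p hp => ?_
    rw [← Finset.card_image_of_injective _ LabelledCubicGraph.edges_injective]
    have := mul_card_cubicOff_le (Finset.mem_offDiag.1 hp).2.2
      (Finset.image LabelledCubicGraph.edges
        (Finset.univ.filter fun G : LabelledCubicGraph n => s(p.1, p.2) ∈ G.edges)) ?_ ?_
    · rwa [Fintype.card_fin] at this
    · intro E hE hm
      exact Finset.mem_image.2 ⟨⟨E, hE.degree_eq, hE.connected⟩, by simpa using hm, rfl⟩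
    · intro E hE
      obtain ⟨G, -, rfl⟩ := Finset.mem_image.1 hE
      exact G.isCubic
  refine h1.trans ?_
  rw [← Finset.mul_sum, ← sum_card_filter_comm]
  have h2 : ∀ G ∈ (Finset.univ : Finset (LabelledCubicGraph n)),
      ((Finset.univ : Finset (Fin n)).offDiag.filter fun p => s(p.1, p.2) ∈ G.edges).card ≤
        3 * n := by
    intro G _
    refine le_trans ?_ ((card_sigma_le_mul Finset.univ (nbrs G.edges) 3
      fun v _ => G.isCubic.card_nbrs_le v).trans_eq (by simp))
    refine card_le_card_of_code (g := id) (fun t => (t.1, t.2)) Function.injective_id ?_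
    rintro ⟨u, v⟩ h
    exact ⟨⟨u, v⟩, by simpa using (Finset.mem_filter.1 h).2, rfl⟩
  have h3 := Finset.sum_le_card_nsmul _ _ _ h2
  rw [Finset.card_univ, smul_eq_mul] at h3
  calc _ ≤ 81 * (Fintype.card (LabelledCubicGraph n) * (3 * n)) := Nat.mul_le_mul_left _ h3
    _ = _ := by ring

theorem mul_card_le_sum_degree (hn : 8 ≤ n) :
    6 * n * Fintype.card (LabelledCubicGraph n) ≤
      87480 * Fintype.card (LabelledCubicGraph n) +
        ∑ G : LabelledCubicGraph n, (whiteheadGraph n).degree G := by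
  classical
  have h1 := Finset.sum_le_sum fun (G : LabelledCubicGraph n)
    (_ : G ∈ Finset.univ) => G.le_degree (by omega)
  rw [Finset.sum_add_distrib, Finset.sum_add_distrib, ← Finset.mul_sum, ← Finset.mul_sum,
    ← Finset.mul_sum, Finset.sum_add_distrib, Finset.sum_const, Finset.card_univ, smul_eq_mul] at h1
  have h2 := sum_hasPendantLoop_le (n := n)
  have h3 := sum_hasDoubleEdge_le (n := n)
  have h4 := sum_hasShortCycle_le (n := n)
  -- For n ≥ 8 one has n² ≤ 4(n - 4)(n - 2), and 972 = 4 · 243. The final constant is 87480 = 90 ·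
  -- 972, where 90 = (24 · (3 + 3) + 36) / 2 collects the three obstruction bounds.
  have h5 : n * totalCubicOff n ≤ 972 * Fintype.card (LabelledCubicGraph n) := by
    have h6 := mul_totalCubicOff_le (n := n)
    obtain ⟨k, rfl⟩ : ∃ k, n = k + 8 := ⟨n - 8, by omega⟩
    rw [show k + 8 - 4 = k + 4 by omega, show k + 8 - 2 = k + 6 by omega] at h6
    refine le_of_mul_le_mul_left ?_ (show 0 < k + 8 by omega)
    calc (k + 8) * ((k + 8) * totalCubicOff (k + 8))
        = (k + 8) * (k + 8) * totalCubicOff (k + 8) := by ring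
      _ ≤ 4 * ((k + 4) * (k + 6)) * totalCubicOff (k + 8) :=
          Nat.mul_le_mul_right _ (by nlinarith)
      _ = 4 * ((k + 4) * (k + 6) * totalCubicOff (k + 8)) := by ring
      _ ≤ 4 * (243 * (k + 8) * Fintype.card (LabelledCubicGraph (k + 8))) :=
          Nat.mul_le_mul_left _ h6
      _ = _ := by ring
  linarith

end Average

theorem proposition4p1 :
    ∃ C : ℝ, ∀ n : ℕ, 0 < n → Even n →
      6 * (n : ℝ) - C ≤ averageDegree (whiteheadGraph n) := by
  refine ⟨87480, fun n hn he => ?_⟩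
  rcases lt_or_ge n 8 with h8 | h8
  · have h1 : (n : ℝ) < 8 := by exact_mod_cast h8
    have h2 : 0 ≤ averageDegree (whiteheadGraph n) := by
      unfold averageDegree; positivity
    linarith
  -- Without a graph the average would be 0 / 0 = 0 and the bound would fail for large n.
  · have := nonempty_labelledCubicGraph hn he
    have hpos : (0 : ℝ) < Fintype.card (LabelledCubicGraph n) := by
      exact_mod_cast Fintype.card_pos
    unfold averageDegree
    rw [le_div_iff₀ hpos]
    have h := mul_card_le_sum_degree h8
    have h' : (6 * n * Fintype.card (LabelledCubicGraph n) : ℝ) ≤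
      87480 * Fintype.card (LabelledCubicGraph n) +
        ∑ G : LabelledCubicGraph n, ((whiteheadGraph n).degree G : ℝ) := by exact_mod_cast h
    linarith
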